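/- Let $R$ be a commutative noetherian ring; all modules are finitely generated. A (first) syzygy of a module $M$ is the kernel of a surjection $P\to M$ with $P$ finitely generated projective, and $\operatorname{Tr}M$ denotes the Auslander transpose of $M$, i.e. the cokernel of $d^*=\operatorname{Hom}_R(d,R)$ for an exact sequence $P_1\xrightarrow{d}P_0\to M\to0$ with $P_0,P_1$ finitely generated projective (unique up to projective summands). For $a,b\in\mathbb{Z}_{\ge0}\cup\{\infty\}$ let $\mathcal{G}_{a,b}$ be the class of $R$-modules $M$ such that $\operatorname{Ext}^i_R(M,R)=0$ for all integers $1\le i\le a$ and $\operatorname{Ext}^j_R(\operatorname{Tr}M,R)=0$ for all integers $1\le j\le b$. The modules in $\mathcal{G}_{\infty,\infty}$ are called totally reflexive. A class of modules is closed under syzygies if it contains every syzygy of each of its members. (1) Let $0<a<\infty$ and $0\le b\le\infty$. Then $\mathcal{G}_{a,b}$ is closed under syzygies if and only if $\mathcal{G}_{a,b}=\mathcal{G}_{\infty,\infty}$. (2) Suppose that $R$ is local, of depth $t$. Let $n\in\mathbb{Z}_{>0}\cup\{\infty\}$ be such that $\mathcal{G}_{n,0}$ is closed under syzygies. Then $n\ge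 t$. If moreover $n\le t+1$, then $R$ is a Gorenstein local ring. -/

import Mathlib

open CategoryTheory

universe u

section

variable {R : Type u} [CommRing R]

/-- `P` is a finitely generated projective `R`-module (an object of `proj R`). -/
def IsFGProjective (P : ModuleCat.{u} R) : Prop :=
  Module.Finite R P ∧ Module.Projective R P

/-- `L` is a first syzygy of `M`: there is an exact sequence `0 → L → P → M → 0`
with `P` finitely generated projective. -/
def IsSyzygy (M L : ModuleCat.{u} R) : Prop :=
  ∃ (P : ModuleCat.{u} R) (i : L →ₗ[R] P) (p : P →ₗ[R] M),
    IsFGProjective P ∧ Function.Injective i ∧ Function.Exact i p ∧ Function.Surjective p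

/-- `T` is an Auslander transpose of `M`: there is an exact sequence `P₁ → P₀ → M → 0`, with first
map `d` and with `P₁`, `P₀` finitely generated projective, such that `T` is isomorphic to the
cokernel of the `R`-dual map `d* : Hom(P₀, R) → Hom(P₁, R)`. -/
def IsTranspose (M T : ModuleCat.{u} R) : Prop :=
  ∃ (P₁ P₀ : ModuleCat.{u} R) (d : P₁ →ₗ[R] P₀) (p : P₀ →ₗ[R] M),
    IsFGProjective P₁ ∧ IsFGProjective P₀ ∧ Function.Exact d p ∧ Function.Surjective p ∧
      Nonempty (T ≃ₗ[R] (Module.Dual R P₁ ⧸ LinearMap.range d.dualMap))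

/-- Over a noetherian ring every finitely generated module has a transpose. -/
theorem exists_isTranspose [IsNoetherianRing R] (M : ModuleCat.{u} R) [Module.Finite R M] :
    ∃ T : ModuleCat.{u} R, IsTranspose M T := by
  obtain ⟨P₀, _, _, _, _, p, hp⟩ := Module.exists_finite_presentation R M
  obtain ⟨P₁, _, _, _, _, q, hq⟩ := Module.exists_finite_presentation R (LinearMap.ker p)
  let d : P₁ →ₗ[R] P₀ := (LinearMap.ker p).subtype ∘ₗ q
  refine ⟨ModuleCat.of R (Module.Dual R P₁ ⧸ LinearMap.range d.dualMap), ModuleCat.of R P₁,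
    ModuleCat.of R P₀, d, p, ⟨inferInstanceAs (Module.Finite R P₁),
      inferInstanceAs (Module.Projective R P₁)⟩, ⟨inferInstanceAs (Module.Finite R P₀),
      inferInstanceAs (Module.Projective R P₀)⟩, ?_, hp, ⟨LinearEquiv.refl R _⟩⟩
  rw [LinearMap.exact_iff]
  change LinearMap.ker p = LinearMap.range d
  rw [LinearMap.range_comp, LinearMap.range_eq_top.2 hq, Submodule.map_top,
    Submodule.range_subtype]

/-- `Ext^i_R(M, R) = 0` for all integers `1 ≤ i ≤ a`, where `a` may be infinite. -/
def ExtVanishesUpTo (a : ℕ∞) (M : ModuleCat.{u} R) : Prop :=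
  ∀ i : ℕ, 1 ≤ i → (i : ℕ∞) ≤ a → Subsingleton (Abelian.Ext M (ModuleCat.of R R) i)

variable (R) in
/-- The subcategory `𝒢_{a,b}` of the category of finitely generated `R`-modules: those `M` with
`Ext^i_R(M, R) = 0 = Ext^j_R(Tr M, R)` for all `1 ≤ i ≤ a` and `1 ≤ j ≤ b`.
(Transposes are unique up to projective summands, so the condition on `Tr M` does not depend on
the chosen transpose; one exists by `exists_isTranspose`.) -/
def GClass (a b : ℕ∞) : ObjectProperty (ModuleCat.{u} R) := fun M =>
  Module.Finite R M ∧ ExtVanishesUpTo a M ∧ ∀ T, IsTranspose M T → ExtVanishesUpTo b T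

variable (R) in
/-- The subcategory of totally reflexive `R`-modules. -/
def TotallyReflexive : ObjectProperty (ModuleCat.{u} R) := GClass R ⊤ ⊤

/-- Closure of a subcategory under (first, hence all) syzygies. -/
def ClosedUnderSyzygies (X : ObjectProperty (ModuleCat.{u} R)) : Prop :=
  ∀ M L : ModuleCat.{u} R, X M → IsSyzygy M L → X L

end

/-- The depth of a local ring: the supremum of the lengths of the `R`-regular sequences contained
in the maximal ideal. -/
noncomputable def localDepth (R : Type u) [CommRing R] [IsLocalRing R] : ℕ∞ :=
  ⨆ (rs : List R) (_ : (∀ r ∈ rs, r ∈ IsLocalRing.maximalIdeal R) ∧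
    RingTheory.Sequence.IsRegular R rs), (rs.length : ℕ∞)

/-- A Gorenstein local ring: a noetherian local ring of finite injective dimension as a module
over itself. -/
structure IsGorensteinLocalRing (R : Type u) [CommRing R] : Prop where
  isLocalRing : IsLocalRing R
  isNoetherianRing : IsNoetherianRing R
  finite_injectiveDimension : ∃ d : ℕ, HasInjectiveDimensionLE (ModuleCat.of R R) d

/-!
Write `V_i(N)` for the vanishing of `Ext^i(N, R)`. If `L` is a syzygy of `M`, with `T = Tr M` and
`T' = Tr L` computed from one projective resolution of `M`, there is an exact sequence
`0 → Ext¹(M, R) → T → B → 0` with `B` a syzygy of `T'`, and `V_1(T')` holds because `L` is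
torsionless (`IsTransposeShift`). Moreover the transpose relation is symmetric, and `V_j(Tr M)` is
independent of the choice of `Tr M`, as it can be expressed through the biduality map
`M → M**` and the groups `Ext^i(M*, R)`.

If `𝒢_{a,b}` is closed under syzygies and `a > 0`, dimension shifting gives `V_i(M)` for all
`i ≥ 1` and all `M` in `𝒢_{a,b}`. For such `M` the modules `Ext¹(Ω^s M, R)` vanish, so `Tr M` is an
`a`-th syzygy of `T' = Tr Ω^a M` and `V_1(T'), …, V_a(T')` hold. As `Tr T' = Ω^a M` satisfies all
`V_j`, the module `T'` lies in `𝒢_{a,b}` when `a` is finite. Thus `T'` satisfies all `V_i`, and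
hence so does `Tr M`: the module `M` is totally reflexive. Conversely, the exact sequence above shows
that syzygies of totally reflexive modules are totally reflexive.

Now let `R` be local with residue field `k` and depth `t`, and let `n` be finite with `𝒢_{n,0}`
closed under syzygies, so that `𝒢_{n,0}` consists of the totally reflexive modules. If `n < t`, then
`k` lies in `𝒢_{n,0}`, but `Hom(k, R) = 0`, so `k` is not torsionless, a contradiction. If
`n ≤ t + 1`, apply the exact sequence to the syzygies of `k`: the modules `Ext¹(Ω^s k, R)` are killed
by the maximal ideal, so their `Ext` into `R` vanishes in degrees below `t`, and by induction on `n`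
the module `Tr Ω^n k` satisfies `V_1, …, V_n` (`exists_transpose_syzygy_residueField`). It is therefore
totally reflexive, and so is `Ω^n k`. Thus `Ext^i(k, R) = 0` for all `i > n`, and a lemma of Bass
(`subsingleton_ext_of_residueField`) together with Baer's criterion shows that `R` has finite
injective dimension. For `n = ∞` the hypothesis `n ≤ t + 1` fails, because the depth is finite.
-/

/-! ### Ext and short exact sequences of linear maps -/

section

variable {R : Type u} [CommRing R] {K P N : ModuleCat.{u} R} {i : K →ₗ[R] P} {p : P →ₗ[R] N}

/-- The short complex `K → P → N` attached to an exact pair of linear maps. -/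
abbrev exactShortComplex (hex : Function.Exact i p) : ShortComplex (ModuleCat.{u} R) :=
  ModuleCat.shortComplexOfCompEqZero i p hex.linearMap_comp_eq_zero

theorem shortExact_of_exact (hi : Function.Injective i) (hex : Function.Exact i p)
    (hp : Function.Surjective p) : (exactShortComplex hex).ShortExact :=
  ModuleCat.shortComplex_shortExact _ hex hi hp

theorem subsingleton_ext_of_linearEquiv {M M' : ModuleCat.{u} R} (e : M ≃ₗ[R] M')
    (Y : ModuleCat.{u} R) (n : ℕ) (h : Subsingleton (Abelian.Ext M Y n)) :
    Subsingleton (Abelian.Ext M' Y n) := by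
  refine subsingleton_of_forall_eq 0 fun x => ?_
  have h1 : (Abelian.Ext.mk₀ (𝟙 M')).comp x (zero_add n) = x := Abelian.Ext.mk₀_id_comp x
  rw [← e.toModuleIso.inv_hom_id, ← Abelian.Ext.mk₀_comp_mk₀_assoc,
    Subsingleton.elim ((Abelian.Ext.mk₀ e.toModuleIso.hom).comp x (zero_add n)) 0,
    Abelian.Ext.comp_zero] at h1
  exact h1.symm

theorem subsingleton_ext_succ_of_projective (P Y : ModuleCat.{u} R) [Module.Projective R P]
    (n : ℕ) : Subsingleton (Abelian.Ext P Y (n + 1)) := by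
  have : Projective P := (IsProjective.iff_projective (R := R) (P := P)).1 inferInstance
  exact Abelian.Ext.subsingleton_of_projective P Y n

/-- If `x` kills `Ext^{n+1}(N, Y)` and `Ext^n(P, Y) = 0`, then `x` kills `Ext^n(K, Y)`. -/
theorem smul_ext_eq_zero_of_exact (hi : Function.Injective i) (hex : Function.Exact i p)
    (hp : Function.Surjective p) (Y : ModuleCat.{u} R) (n : ℕ)
    (hP : Subsingleton (Abelian.Ext P Y n)) (x : R)
    (hN : ∀ e : Abelian.Ext N Y (n + 1), x • e = 0) (e : Abelian.Ext K Y n) : x • e = 0 := by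
  have hS := shortExact_of_exact hi hex hp
  obtain ⟨y, hy⟩ := Abelian.Ext.contravariant_sequence_exact₁ hS Y (x • e) (add_comm 1 n)
    (by rw [Abelian.Ext.comp_smul]; exact hN _)
  rw [← hy, @Subsingleton.elim _ hP y 0, Abelian.Ext.comp_zero]

theorem subsingleton_ext_right (hi : Function.Injective i) (hex : Function.Exact i p)
    (hp : Function.Surjective p) (Y : ModuleCat.{u} R) (n : ℕ)
    (hK : Subsingleton (Abelian.Ext K Y n)) (hP : Subsingleton (Abelian.Ext P Y (n + 1))) :
    Subsingleton (Abelian.Ext N Y (n + 1)) := by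
  have hS := shortExact_of_exact hi hex hp
  refine subsingleton_of_forall_eq 0 fun e => ?_
  obtain ⟨y, hy⟩ := Abelian.Ext.contravariant_sequence_exact₃ hS Y e (@Subsingleton.elim _ hP _ _)
    (add_comm 1 n)
  rw [← hy, @Subsingleton.elim _ hK y 0, Abelian.Ext.comp_zero]

theorem subsingleton_ext_left (hi : Function.Injective i) (hex : Function.Exact i p)
    (hp : Function.Surjective p) (Y : ModuleCat.{u} R) (n : ℕ)
    (hP : Subsingleton (Abelian.Ext P Y n)) (hN : Subsingleton (Abelian.Ext N Y (n + 1))) :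
    Subsingleton (Abelian.Ext K Y n) := by
  refine subsingleton_of_forall_eq 0 fun e => ?_
  rw [← one_smul R e]
  exact smul_ext_eq_zero_of_exact hi hex hp Y n hP 1 (fun _ => Subsingleton.elim _ _) e

theorem subsingleton_ext_middle (hi : Function.Injective i) (hex : Function.Exact i p)
    (hp : Function.Surjective p) (Y : ModuleCat.{u} R) (n : ℕ)
    (hK : Subsingleton (Abelian.Ext K Y n)) (hN : Subsingleton (Abelian.Ext N Y n)) :
    Subsingleton (Abelian.Ext P Y n) := by
  have hS := shortExact_of_exact hi hex hp
  refine subsingleton_of_forall_eq 0 fun e => ?_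
  obtain ⟨y, hy⟩ := Abelian.Ext.contravariant_sequence_exact₂ hS Y e (@Subsingleton.elim _ hK _ _)
  rw [← hy, @Subsingleton.elim _ hN y 0, Abelian.Ext.comp_zero]

/-- Dimension shifting. -/
theorem subsingleton_ext_succ_succ_iff [Module.Projective R P] (hi : Function.Injective i)
    (hex : Function.Exact i p) (hp : Function.Surjective p) (Y : ModuleCat.{u} R) (n : ℕ) :
    Subsingleton (Abelian.Ext N Y (n + 2)) ↔ Subsingleton (Abelian.Ext K Y (n + 1)) :=
  ⟨subsingleton_ext_left hi hex hp Y (n + 1) (subsingleton_ext_succ_of_projective P Y n),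
    fun h => subsingleton_ext_right hi hex hp Y (n + 1) h
      (subsingleton_ext_succ_of_projective P Y (n + 1))⟩

/-- If `x` kills `Ext¹(N, Y)`, then the multiple by `x` of a linear map `K → Y` extends to `P`. -/
theorem exists_extension_smul (hi : Function.Injective i) (hex : Function.Exact i p)
    (hp : Function.Surjective p) (Y : ModuleCat.{u} R) (x : R)
    (hN : ∀ e : Abelian.Ext N Y 1, x • e = 0) (f : K →ₗ[R] Y) :
    ∃ g : P →ₗ[R] Y, g ∘ₗ i = x • f := by
  have hS := shortExact_of_exact hi hex hp
  obtain ⟨y, hy⟩ := Abelian.Ext.contravariant_sequence_exact₁ hS Y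
    (x • Abelian.Ext.mk₀ (ModuleCat.ofHom f)) (add_comm 1 0)
    (by rw [Abelian.Ext.comp_smul]; exact hN _)
  obtain ⟨g, rfl⟩ := (Abelian.Ext.mk₀_bijective _ _).2 y
  rw [Abelian.Ext.mk₀_comp_mk₀, ← Abelian.Ext.mk₀_smul] at hy
  have := (Abelian.Ext.mk₀_bijective _ _).1 hy
  exact ⟨g.hom, by simpa using congrArg ModuleCat.Hom.hom this⟩

/-- For a presentation `0 → K → P → N → 0` with `P` projective, `Ext¹(N, Y)` vanishes exactly
when all linear maps `K → Y` extend to `P`. -/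
theorem subsingleton_ext_one_iff [Module.Projective R P] (hi : Function.Injective i)
    (hex : Function.Exact i p) (hp : Function.Surjective p) (Y : ModuleCat.{u} R) :
    Subsingleton (Abelian.Ext N Y 1) ↔ ∀ f : K →ₗ[R] Y, ∃ g : P →ₗ[R] Y, g ∘ₗ i = f := by
  refine ⟨fun h f => ?_, fun h => subsingleton_of_forall_eq 0 fun e => ?_⟩
  · simpa using exists_extension_smul hi hex hp Y 1 (fun _ => Subsingleton.elim _ _) f
  · have hS := shortExact_of_exact hi hex hp
    have hP := subsingleton_ext_succ_of_projective P Y 0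
    obtain ⟨y, rfl⟩ := Abelian.Ext.contravariant_sequence_exact₃ hS Y e
      (@Subsingleton.elim _ hP _ _) (add_comm 1 0)
    obtain ⟨f, rfl⟩ := (Abelian.Ext.mk₀_bijective _ _).2 y
    obtain ⟨g, hg⟩ := h f.hom
    have : f = (exactShortComplex hex).f ≫ ModuleCat.ofHom g := by
      ext1
      exact hg.symm
    rw [this, ← Abelian.Ext.mk₀_comp_mk₀, ← Abelian.Ext.comp_assoc_of_second_deg_zero,
      hS.extClass_comp, Abelian.Ext.zero_comp]

end

/-! ### Auslander transposes -/

section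

variable {R : Type u} [CommRing R]

theorem Function.Exact.exists_factor {M N P Q : Type*} [AddCommGroup M] [AddCommGroup N]
    [AddCommGroup P] [AddCommGroup Q] [Module R M] [Module R N] [Module R P] [Module R Q]
    {d : M →ₗ[R] N} {p : N →ₗ[R] P} (h : Function.Exact d p) (hp : Function.Surjective p)
    (f : N →ₗ[R] Q) (hf : f ∘ₗ d = 0) : ∃ g : P →ₗ[R] Q, g ∘ₗ p = f := by
  refine ⟨(LinearMap.range d).liftQ f ?_ ∘ₗ (h.linearEquivOfSurjective hp).symm.toLinearMap, ?_⟩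
  · rintro _ ⟨x, rfl⟩
    exact LinearMap.congr_fun hf x
  · ext x
    have : (h.linearEquivOfSurjective hp).symm (p x) = Submodule.Quotient.mk x := by
      rw [LinearEquiv.symm_apply_eq]
      rfl
    simp [this]

theorem Function.Exact.exact_dualMap_rangeRestrict {M N P : Type*} [AddCommGroup M]
    [AddCommGroup N] [AddCommGroup P] [Module R M] [Module R N] [Module R P]
    {d : M →ₗ[R] N} {p : N →ₗ[R] P} (h : Function.Exact d p) (hp : Function.Surjective p) :
    Function.Exact p.dualMap d.dualMap.rangeRestrict := by
  intro f
  constructor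
  · intro hf
    exact h.exists_factor hp f (congrArg Subtype.val hf)
  · rintro ⟨g, rfl⟩
    ext x
    simp [h.apply_apply_eq_zero]

theorem LinearMap.exact_subtype_range_comp_mkQ {M N T : Type*} [AddCommGroup M]
    [AddCommGroup N] [AddCommGroup T] [Module R M] [Module R N] [Module R T] (f : M →ₗ[R] N)
    (e : (N ⧸ LinearMap.range f) ≃ₗ[R] T) :
    Function.Exact (LinearMap.range f).subtype (e.toLinearMap ∘ₗ (LinearMap.range f).mkQ) := by
  intro x
  simp

/-- The transpose relation is symmetric, since finitely generated projective modules are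
reflexive. -/
theorem IsTranspose.symm {M T : ModuleCat.{u} R} (h : IsTranspose M T) : IsTranspose T M := by
  obtain ⟨P₁, P₀, d, p, ⟨_, _⟩, ⟨_, _⟩, hex, hp, ⟨e⟩⟩ := h
  refine ⟨ModuleCat.of R (Module.Dual R P₀), ModuleCat.of R (Module.Dual R P₁), d.dualMap,
    e.symm.toLinearMap ∘ₗ (LinearMap.range d.dualMap).mkQ,
    ⟨inferInstanceAs (Module.Finite R (Module.Dual R P₀)),
      inferInstanceAs (Module.Projective R (Module.Dual R P₀))⟩,
    ⟨inferInstanceAs (Module.Finite R (Module.Dual R P₁)),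
      inferInstanceAs (Module.Projective R (Module.Dual R P₁))⟩, ?_,
    e.symm.surjective.comp (Submodule.mkQ_surjective _), ⟨?_⟩⟩
  · intro x
    simp
  · refine (hex.linearEquivOfSurjective hp).symm ≪≫ₗ
      Submodule.Quotient.equiv _ _ (Module.evalEquiv R P₀) ?_
    have : (Module.evalEquiv R P₀).toLinearMap ∘ₗ d =
        d.dualMap.dualMap ∘ₗ (Module.evalEquiv R P₁).toLinearMap := by
      ext x f
      simp
    change (LinearMap.range d).map (Module.evalEquiv R P₀).toLinearMap = _
    rw [← LinearMap.range_comp, this, LinearMap.range_comp, LinearEquiv.range, Submodule.map_top]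

theorem IsTranspose.finite {M T : ModuleCat.{u} R} (h : IsTranspose M T) : Module.Finite R M := by
  obtain ⟨_, _, _, p, _, ⟨_, _⟩, _, hp, _⟩ := h
  exact Module.Finite.of_surjective p hp

/-- `Ext¹(Tr M, R)` is the kernel of the biduality map of `M`. -/
theorem IsTranspose.subsingleton_ext_one_iff {M T : ModuleCat.{u} R} (h : IsTranspose M T) :
    Subsingleton (Abelian.Ext T (ModuleCat.of R R) 1) ↔
      ∀ m : M, (∀ f : Module.Dual R M, f m = 0) → m = 0 := by
  obtain ⟨P₁, P₀, d, p, ⟨_, _⟩, ⟨_, _⟩, hex, hp, ⟨e⟩⟩ := h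
  have : Module.Projective R (ModuleCat.of R (Module.Dual R P₁)) :=
    inferInstanceAs (Module.Projective R (Module.Dual R P₁))
  rw [_root_.subsingleton_ext_one_iff (K := ModuleCat.of R (LinearMap.range d.dualMap))
    (P := ModuleCat.of R (Module.Dual R P₁)) (LinearMap.range d.dualMap).injective_subtype
    (LinearMap.exact_subtype_range_comp_mkQ d.dualMap e.symm)
    (e.symm.surjective.comp (Submodule.mkQ_surjective _))]
  constructor
  · intro h m hm
    obtain ⟨x, rfl⟩ := hp m
    -- Evaluation at `x` factors through the range of `d.dualMap`, because `p x` is killed by `M*`.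
    obtain ⟨g, hg⟩ := Function.Exact.exists_factor (M := Module.Dual R M)
      (N := Module.Dual R P₀) (P := LinearMap.range d.dualMap)
      (hex.exact_dualMap_rangeRestrict hp)
      d.dualMap.surjective_rangeRestrict (Module.Dual.eval R P₀ x) (by ext f; simpa using hm f)
    obtain ⟨g', hg'⟩ := h g
    obtain ⟨y, rfl⟩ := (Module.evalEquiv R P₁).surjective g'
    have : d y = x := by
      refine (Module.evalEquiv R P₀).injective ?_
      ext f
      have h1 := LinearMap.congr_fun hg f
      have h2 := LinearMap.congr_fun hg' (d.dualMap.rangeRestrict f)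
      simp at h1 h2
      simp [← h1, ← h2]
    rw [← this, hex.apply_apply_eq_zero]
  · intro h g
    obtain ⟨x, hx⟩ := (Module.evalEquiv R P₀).surjective (g ∘ₗ d.dualMap.rangeRestrict)
    have hx' : ∀ f : Module.Dual R P₀, g (d.dualMap.rangeRestrict f) = f x := fun f => by
      simpa using (LinearMap.congr_fun hx f).symm
    obtain ⟨y, rfl⟩ := (hex x).1 (h (p x) fun f => by
      have h1 := hx' (p.dualMap f)
      rw [((hex.exact_dualMap_rangeRestrict hp) _).2 ⟨f, rfl⟩, map_zero] at h1
      exact h1.symm)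
    refine ⟨Module.Dual.eval R P₁ y, ?_⟩
    ext ⟨_, f, rfl⟩
    exact (hx' f).symm

theorem IsTranspose.subsingleton_ext_two_iff {M T : ModuleCat.{u} R} (h : IsTranspose M T) :
    Subsingleton (Abelian.Ext T (ModuleCat.of R R) 2) ↔
      Function.Surjective (Module.Dual.eval R M) := by
  obtain ⟨P₁, P₀, d, p, ⟨_, _⟩, ⟨_, _⟩, hex, hp, ⟨e⟩⟩ := h
  have : Module.Projective R (ModuleCat.of R (Module.Dual R P₁)) :=
    inferInstanceAs (Module.Projective R (Module.Dual R P₁))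
  have : Module.Projective R (ModuleCat.of R (Module.Dual R P₀)) :=
    inferInstanceAs (Module.Projective R (Module.Dual R P₀))
  rw [subsingleton_ext_succ_succ_iff (K := ModuleCat.of R (LinearMap.range d.dualMap))
    (P := ModuleCat.of R (Module.Dual R P₁)) (LinearMap.range d.dualMap).injective_subtype
    (LinearMap.exact_subtype_range_comp_mkQ d.dualMap e.symm)
    (e.symm.surjective.comp (Submodule.mkQ_surjective _)),
    _root_.subsingleton_ext_one_iff (K := ModuleCat.of R (Module.Dual R M))
    (P := ModuleCat.of R (Module.Dual R P₀)) (LinearMap.dualMap_injective_of_surjective hp)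
    (hex.exact_dualMap_rangeRestrict hp) d.dualMap.surjective_rangeRestrict]
  constructor
  · intro h f
    obtain ⟨g, hg⟩ := h f
    obtain ⟨x, rfl⟩ := (Module.evalEquiv R P₀).surjective g
    exact ⟨p x, hg⟩
  · intro h f
    obtain ⟨m, rfl⟩ := h f
    obtain ⟨x, rfl⟩ := hp m
    exact ⟨Module.Dual.eval R P₀ x, rfl⟩

theorem IsTranspose.subsingleton_ext_add_three_iff {M T : ModuleCat.{u} R} (h : IsTranspose M T)
    (n : ℕ) : Subsingleton (Abelian.Ext T (ModuleCat.of R R) (n + 3)) ↔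
      Subsingleton (Abelian.Ext (ModuleCat.of R (Module.Dual R M)) (ModuleCat.of R R)
        (n + 1)) := by
  obtain ⟨P₁, P₀, d, p, ⟨_, _⟩, ⟨_, _⟩, hex, hp, ⟨e⟩⟩ := h
  have : Module.Projective R (ModuleCat.of R (Module.Dual R P₁)) :=
    inferInstanceAs (Module.Projective R (Module.Dual R P₁))
  have : Module.Projective R (ModuleCat.of R (Module.Dual R P₀)) :=
    inferInstanceAs (Module.Projective R (Module.Dual R P₀))
  rw [subsingleton_ext_succ_succ_iff (K := ModuleCat.of R (LinearMap.range d.dualMap))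
    (P := ModuleCat.of R (Module.Dual R P₁)) (LinearMap.range d.dualMap).injective_subtype
    (LinearMap.exact_subtype_range_comp_mkQ d.dualMap e.symm)
    (e.symm.surjective.comp (Submodule.mkQ_surjective _)),
    subsingleton_ext_succ_succ_iff (K := ModuleCat.of R (Module.Dual R M))
    (P := ModuleCat.of R (Module.Dual R P₀)) (LinearMap.dualMap_injective_of_surjective hp)
    (hex.exact_dualMap_rangeRestrict hp) d.dualMap.surjective_rangeRestrict]

/-- The vanishing of `Ext^j(Tr M, R)` for `j ≥ 1` does not depend on the choice of a transpose:
it can be read off from the biduality map of `M` and from the dual of `M`. -/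
theorem IsTranspose.subsingleton_ext_congr {M T T' : ModuleCat.{u} R} (h : IsTranspose M T)
    (h' : IsTranspose M T') {j : ℕ} (hj : 1 ≤ j)
    (hT : Subsingleton (Abelian.Ext T (ModuleCat.of R R) j)) :
    Subsingleton (Abelian.Ext T' (ModuleCat.of R R) j) := by
  obtain _ | _ | _ | j := j
  · omega
  · exact h'.subsingleton_ext_one_iff.2 (h.subsingleton_ext_one_iff.1 hT)
  · exact h'.subsingleton_ext_two_iff.2 (h.subsingleton_ext_two_iff.1 hT)
  · exact (h'.subsingleton_ext_add_three_iff j).2 ((h.subsingleton_ext_add_three_iff j).1 hT)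

end

/-! ### Transposes of a module and of its syzygy -/

section

variable {R : Type u} [CommRing R]

/-- The relation between a transpose `T` of `M` and a transpose `T'` of a syzygy of `M`:
`Ext¹(T', R) = 0`, and some quotient `T ⧸ E` is a syzygy of `T'`. The submodule `E` stands for
`Ext¹(M, R)`, but of this identification only the following is recorded: every scalar that kills
`Ext¹(M, R)` kills `E`. -/
def IsTransposeShift (M T T' : ModuleCat.{u} R) : Prop :=
  Subsingleton (Abelian.Ext T' (ModuleCat.of R R) 1) ∧
    ∃ E : Submodule R T,
      (∀ x : R, (∀ e : Abelian.Ext M (ModuleCat.of R R) 1, x • e = 0) → ∀ y ∈ E, x • y = 0) ∧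
        IsSyzygy T' (ModuleCat.of R (T ⧸ E))

theorem isTransposeShift_of_exact {P₂ P₁ P₀ M T T' : ModuleCat.{u} R} {d₂ : P₂ →ₗ[R] P₁}
    {d₁ : P₁ →ₗ[R] P₀} {p : P₀ →ₗ[R] M} (hP₂ : IsFGProjective P₂) (hP₁ : IsFGProjective P₁)
    (hP₀ : IsFGProjective P₀) (h₂ : Function.Exact d₂ d₁) (h₁ : Function.Exact d₁ p)
    (hp : Function.Surjective p) (e : T ≃ₗ[R] (Module.Dual R P₁ ⧸ LinearMap.range d₁.dualMap))
    (e' : T' ≃ₗ[R] (Module.Dual R P₂ ⧸ LinearMap.range d₂.dualMap)) :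
    IsTransposeShift M T T' := by
  have := hP₂.1; have := hP₂.2; have := hP₁.1; have := hP₁.2; have := hP₀.1; have := hP₀.2
  constructor
  · -- The syzygy `range d₁` is a submodule of the reflexive module `P₀`, hence torsionless.
    have hL : IsTranspose (ModuleCat.of R (LinearMap.range d₁)) T' := by
      refine ⟨P₂, P₁, d₂, d₁.rangeRestrict, hP₂, hP₁, fun x => ?_,
        d₁.surjective_rangeRestrict, ⟨e'⟩⟩
      rw [← h₂ x, ← Subtype.coe_inj]
      rfl
    rw [hL.subsingleton_ext_one_iff]
    rintro ⟨x, hx⟩ h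
    ext
    refine (Module.evalEquiv R P₀).injective ?_
    ext f
    simpa using h (f ∘ₗ (LinearMap.range d₁).subtype)
  have hd : LinearMap.range d₁.dualMap ≤ LinearMap.ker d₂.dualMap := by
    rintro _ ⟨f, rfl⟩
    ext x
    simp [h₂.apply_apply_eq_zero]
  let φ : T →ₗ[R] Module.Dual R P₂ :=
    (LinearMap.range d₁.dualMap).liftQ d₂.dualMap hd ∘ₗ e.toLinearMap
  have hφ : LinearMap.range φ = LinearMap.range d₂.dualMap := by
    rw [LinearMap.range_comp, LinearEquiv.range, Submodule.map_top, Submodule.range_liftQ]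
  refine ⟨LinearMap.ker φ, fun x hx y hy => ?_, ModuleCat.of R (Module.Dual R P₂),
    (LinearMap.ker φ).liftQ φ le_rfl,
    e'.symm.toLinearMap ∘ₗ (LinearMap.range d₂.dualMap).mkQ,
    ⟨inferInstanceAs (Module.Finite R (Module.Dual R P₂)),
      inferInstanceAs (Module.Projective R (Module.Dual R P₂))⟩,
    LinearMap.ker_eq_bot.1 (Submodule.ker_liftQ_eq_bot _ _ _ le_rfl), fun x => ?_,
    e'.symm.surjective.comp (Submodule.mkQ_surjective _)⟩
  · obtain ⟨z, rfl⟩ := e.symm.surjective y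
    obtain ⟨f, rfl⟩ := Submodule.mkQ_surjective _ z
    have hf : d₂.dualMap f = 0 := by simpa [φ] using hy
    -- `f` descends to the syzygy `range d₁`, and the multiple by `x` of the induced map extends
    -- to `P₀`.
    obtain ⟨g, hg⟩ := Function.Exact.exists_factor (p := d₁.rangeRestrict) (d := d₂)
      (fun x => by rw [← h₂ x, ← Subtype.coe_inj]; rfl) d₁.surjective_rangeRestrict f hf
    obtain ⟨k, hk⟩ := exists_extension_smul (K := ModuleCat.of R (LinearMap.range d₁))
      (i := (LinearMap.range d₁).subtype) (LinearMap.range d₁).injective_subtype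
      (fun x => by rw [h₁ x]; simp) hp (ModuleCat.of R R) x hx g
    rw [← map_smul, ← map_smul]
    have : x • f = d₁.dualMap k := by
      ext y
      have := LinearMap.congr_fun hk (d₁.rangeRestrict y)
      simpa [← hg] using this.symm
    rw [this, Submodule.mkQ_apply, (Submodule.Quotient.mk_eq_zero _).2 (LinearMap.mem_range_self _ k), map_zero]
  · have : x ∈ LinearMap.range d₂.dualMap ↔ x ∈ LinearMap.range ((LinearMap.ker φ).liftQ φ le_rfl)
    · rw [Submodule.range_liftQ, hφ]
    exact Iff.trans (by simp) this

theorem IsSyzygy.finite [IsNoetherianRing R] {M L : ModuleCat.{u} R} (h : IsSyzygy M L) :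
    Module.Finite R L := by
  obtain ⟨P, i, p, ⟨_, _⟩, hi, _, _⟩ := h
  exact Module.Finite.of_injective i hi

theorem IsSyzygy.subsingleton_ext_iff {M L : ModuleCat.{u} R} (h : IsSyzygy M L)
    (Y : ModuleCat.{u} R) (n : ℕ) :
    Subsingleton (Abelian.Ext M Y (n + 2)) ↔ Subsingleton (Abelian.Ext L Y (n + 1)) := by
  obtain ⟨P, i, p, ⟨_, _⟩, hi, hex, hp⟩ := h
  exact subsingleton_ext_succ_succ_iff hi hex hp Y n

theorem exists_isSyzygy (M : ModuleCat.{u} R) [Module.Finite R M] :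
    ∃ L : ModuleCat.{u} R, IsSyzygy M L := by
  obtain ⟨P, _, _, _, _, p, hp⟩ := Module.exists_finite_presentation R M
  exact ⟨ModuleCat.of R (LinearMap.ker p), ModuleCat.of R P, (LinearMap.ker p).subtype, p,
    ⟨inferInstanceAs (Module.Finite R P), inferInstanceAs (Module.Projective R P)⟩,
    (LinearMap.ker p).injective_subtype, p.exact_subtype_ker_map, hp⟩

/-- Every transpose of a syzygy of `M` is a shift of a transpose of `M`. -/
theorem IsSyzygy.exists_isTransposeShift {M L T' : ModuleCat.{u} R} (hL : IsSyzygy M L)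
    (hT' : IsTranspose L T') : ∃ T, IsTranspose M T ∧ IsTransposeShift M T T' := by
  obtain ⟨P₀, i, p, hP₀, hi, hex, hp⟩ := hL
  obtain ⟨P₂, P₁, d₂, q, hP₂, hP₁, hex', hq, ⟨e'⟩⟩ := hT'
  have h₁ : Function.Exact (i ∘ₗ q) p := fun x => by
    rw [hex x, LinearMap.coe_comp, Set.range_comp, hq.range_eq, Set.image_univ]
  have h₂ : Function.Exact d₂ (i ∘ₗ q) := fun x => by
    rw [← hex' x, LinearMap.comp_apply, map_eq_zero_iff i hi]
  exact ⟨ModuleCat.of R (Module.Dual R P₁ ⧸ LinearMap.range (i ∘ₗ q).dualMap),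
    ⟨P₁, P₀, i ∘ₗ q, p, hP₁, hP₀, h₁, hp, ⟨LinearEquiv.refl R _⟩⟩,
    isTransposeShift_of_exact hP₂ hP₁ hP₀ h₂ h₁ hp (LinearEquiv.refl R _) e'⟩

/-- Every transpose of `M` has a shift which is a transpose of a syzygy of `M`. -/
theorem IsTranspose.exists_isTransposeShift [IsNoetherianRing R] {M T : ModuleCat.{u} R}
    (hT : IsTranspose M T) :
    ∃ L T', IsSyzygy M L ∧ IsTranspose L T' ∧ IsTransposeShift M T T' := by
  obtain ⟨P₁, P₀, d₁, p, hP₁, hP₀, h₁, hp, ⟨e⟩⟩ := hT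
  have := hP₁.1
  obtain ⟨P₂, _, _, _, _, q, hq⟩ := Module.exists_finite_presentation R (LinearMap.ker d₁)
  have hP₂ : IsFGProjective (ModuleCat.of R P₂) :=
    ⟨inferInstanceAs (Module.Finite R P₂), inferInstanceAs (Module.Projective R P₂)⟩
  let d₂ : P₂ →ₗ[R] P₁ := (LinearMap.ker d₁).subtype ∘ₗ q
  have h₂ : Function.Exact d₂ d₁ := by
    rw [LinearMap.exact_iff, LinearMap.range_comp, LinearMap.range_eq_top.2 hq, Submodule.map_top,
      Submodule.range_subtype]
  refine ⟨ModuleCat.of R (LinearMap.range d₁),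
    ModuleCat.of R (Module.Dual R P₂ ⧸ LinearMap.range d₂.dualMap),
    ⟨P₀, (LinearMap.range d₁).subtype, p, hP₀, (LinearMap.range d₁).injective_subtype,
      fun x => by rw [h₁ x]; simp, hp⟩,
    ⟨ModuleCat.of R P₂, P₁, d₂, d₁.rangeRestrict, hP₂, hP₁, fun x => ?_,
      d₁.surjective_rangeRestrict, ⟨LinearEquiv.refl R _⟩⟩,
    isTransposeShift_of_exact hP₂ hP₁ hP₀ h₂ h₁ hp e (LinearEquiv.refl R _)⟩
  rw [← h₂ x, ← Subtype.coe_inj]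
  rfl

/-- If `Ext¹(M, R) = 0`, then `Ext^{j+1}(T', R)` vanishes exactly when `Ext^j(T, R)` does. -/
theorem IsTransposeShift.subsingleton_ext_iff {M T T' : ModuleCat.{u} R}
    (h : IsTransposeShift M T T') (hM : Subsingleton (Abelian.Ext M (ModuleCat.of R R) 1))
    (n : ℕ) : Subsingleton (Abelian.Ext T' (ModuleCat.of R R) (n + 2)) ↔
      Subsingleton (Abelian.Ext T (ModuleCat.of R R) (n + 1)) := by
  obtain ⟨-, E, hE, hs⟩ := h
  have : E = ⊥ := (Submodule.eq_bot_iff E).2 fun y hy => by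
    simpa using hE 1 (fun _ => Subsingleton.elim _ _) y hy
  subst this
  rw [hs.subsingleton_ext_iff]
  let e : (T ⧸ (⊥ : Submodule R T)) ≃ₗ[R] T := Submodule.quotEquivOfEqBot ⊥ rfl
  exact ⟨subsingleton_ext_of_linearEquiv (M := ModuleCat.of R (T ⧸ (⊥ : Submodule R T))) e _ _,
    subsingleton_ext_of_linearEquiv (M' := ModuleCat.of R (T ⧸ (⊥ : Submodule R T))) e.symm _ _⟩

/-! ### The classes `𝒢_{a,b}` and closure under syzygies -/

theorem TotallyReflexive.subsingleton_ext {M : ModuleCat.{u} R} (hM : TotallyReflexive R M)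
    (j : ℕ) : Subsingleton (Abelian.Ext M (ModuleCat.of R R) (j + 1)) :=
  hM.2.1 (j + 1) (by omega) le_top

theorem TotallyReflexive.subsingleton_ext_transpose {M T : ModuleCat.{u} R}
    (hM : TotallyReflexive R M) (hT : IsTranspose M T) (j : ℕ) :
    Subsingleton (Abelian.Ext T (ModuleCat.of R R) (j + 1)) :=
  hM.2.2 T hT (j + 1) (by omega) le_top

variable (R) in
theorem totallyReflexive_le_gClass (a b : ℕ∞) : TotallyReflexive R ≤ GClass R a b :=
  fun _ hM => ⟨hM.1, fun i hi _ => hM.2.1 i hi le_top, fun T hT i hi _ => hM.2.2 T hT i hi le_top⟩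

variable (R) in
theorem closedUnderSyzygies_totallyReflexive [IsNoetherianRing R] :
    ClosedUnderSyzygies (TotallyReflexive R) := by
  intro M L hM hL
  refine ⟨hL.finite, fun i hi _ => ?_, fun T' hT' i hi _ => ?_⟩
  · obtain ⟨i, rfl⟩ := Nat.exists_eq_add_of_le' hi
    exact (hL.subsingleton_ext_iff _ i).1 (hM.subsingleton_ext (i + 1))
  · obtain ⟨T, hT, hs⟩ := hL.exists_isTransposeShift hT'
    obtain _ | _ | i := i
    · omega
    · exact hs.1
    · exact (hs.subsingleton_ext_iff (hM.subsingleton_ext 0) i).2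
        (hM.subsingleton_ext_transpose hT i)

theorem ClosedUnderSyzygies.subsingleton_ext {a b : ℕ∞} (ha : 0 < a)
    (h : ClosedUnderSyzygies (GClass R a b)) {M : ModuleCat.{u} R} (hM : GClass R a b M) (j : ℕ) :
    Subsingleton (Abelian.Ext M (ModuleCat.of R R) (j + 1)) := by
  induction j generalizing M with
  | zero => exact hM.2.1 1 le_rfl (by simpa using Order.one_le_iff_pos.2 ha)
  | succ j ih =>
    have := hM.1
    obtain ⟨L, hL⟩ := exists_isSyzygy M
    exact (hL.subsingleton_ext_iff _ j).2 (ih (h M L hM hL))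

/-- If `Ext^i(M, R) = 0` for all `i ≥ 1`, then a transpose of the `n`-th syzygy of `M` has
`Ext^i(-, R) = 0` for `1 ≤ i ≤ n`, followed by the groups `Ext^j(Tr M, R)`. -/
theorem IsTranspose.exists_iterated_shift [IsNoetherianRing R] {M T : ModuleCat.{u} R}
    (hT : IsTranspose M T) (hM : ∀ j, Subsingleton (Abelian.Ext M (ModuleCat.of R R) (j + 1)))
    (n : ℕ) : ∃ L T', IsTranspose L T' ∧
      (∀ j, Subsingleton (Abelian.Ext L (ModuleCat.of R R) (j + 1))) ∧
      (∀ j < n, Subsingleton (Abelian.Ext T' (ModuleCat.of R R) (j + 1))) ∧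
      ∀ j, Subsingleton (Abelian.Ext T' (ModuleCat.of R R) (j + n + 1)) →
        Subsingleton (Abelian.Ext T (ModuleCat.of R R) (j + 1)) := by
  induction n with
  | zero => exact ⟨M, T, hT, hM, by simp, fun j h => h⟩
  | succ n ih =>
    obtain ⟨M', T', hT', hM', h0, h1⟩ := ih
    obtain ⟨L, T'', hL, hT'', hs⟩ := hT'.exists_isTransposeShift
    refine ⟨L, T'', hT'', fun j => (hL.subsingleton_ext_iff _ j).1 (hM' (j + 1)), fun j hj => ?_,
      fun j h => h1 j ((hs.subsingleton_ext_iff (hM' 0) (j + n)).1 h)⟩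
    obtain _ | j := j
    · exact hs.1
    · exact (hs.subsingleton_ext_iff (hM' 0) j).2 (h0 j (by omega))

theorem gClass_eq_totallyReflexive [IsNoetherianRing R] {a b : ℕ∞} (ha : 0 < a) (ha' : a < ⊤)
    (h : ClosedUnderSyzygies (GClass R a b)) : GClass R a b = TotallyReflexive R := by
  refine le_antisymm (fun M hM => ?_) (totallyReflexive_le_gClass R a b)
  lift a to ℕ using ha'.ne
  have hext := h.subsingleton_ext ha hM
  refine ⟨hM.1, fun i hi _ => ?_, fun T hT j hj _ => ?_⟩
  · obtain ⟨i, rfl⟩ := Nat.exists_eq_add_of_le' hi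
    exact hext i
  · obtain ⟨j, rfl⟩ := Nat.exists_eq_add_of_le' hj
    obtain ⟨L, T', hT', hL, h0, h1⟩ := hT.exists_iterated_shift hext a
    -- `T'` lies in `𝒢_{a,b}`: its transposes have the same `Ext` vanishing as `L`.
    have hG : GClass R a b T' := by
      refine ⟨hT'.symm.finite, fun i hi hia => ?_, fun S hS i hi _ => ?_⟩
      · obtain ⟨i, rfl⟩ := Nat.exists_eq_add_of_le' hi
        exact h0 i (by exact_mod_cast hia)
      · refine hT'.symm.subsingleton_ext_congr hS hi ?_
        obtain ⟨i, rfl⟩ := Nat.exists_eq_add_of_le' hi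
        exact hL i
    exact h1 j (h.subsingleton_ext ha hG (j + a))

end

/-! ### Regular sequences and transposes of syzygies of the residue field -/

section

open IsLocalRing

variable {R : Type u} [CommRing R]

theorem smul_ext_eq_zero_of_forall_smul {M : ModuleCat.{u} R} {x : R} (hx : ∀ m : M, x • m = 0)
    (Y : ModuleCat.{u} R) (n : ℕ) (e : Abelian.Ext M Y n) : x • e = 0 := by
  have h1 : x • 𝟙 M = 0 := by
    ext m
    exact hx m
  rw [← Abelian.Ext.mk₀_id_comp e, ← Abelian.Ext.smul_comp, ← Abelian.Ext.mk₀_smul, h1,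
    Abelian.Ext.mk₀_zero, Abelian.Ext.zero_comp]

variable [IsLocalRing R]

theorem smul_residueField_eq_zero {x : R} (hx : x ∈ maximalIdeal R) (y : ResidueField R) :
    x • y = 0 := by
  rw [Algebra.smul_def, ResidueField.algebraMap_eq, (residue_eq_zero_iff x).2 hx, zero_mul]

theorem exists_isRegular_of_le_localDepth {n : ℕ} (hn : (n : ℕ∞) ≤ localDepth R) :
    ∃ rs : List R, (∀ r ∈ rs, r ∈ maximalIdeal R) ∧ RingTheory.Sequence.IsRegular R rs ∧
      n ≤ rs.length := by
  obtain _ | n := n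
  · exact ⟨[], by simp, by simp [RingTheory.Sequence.isRegular_iff], by simp⟩
  · have : (n : ℕ∞) < localDepth R := lt_of_lt_of_le (by exact_mod_cast n.lt_succ_self) hn
    simp only [localDepth, lt_iSup_iff] at this
    obtain ⟨rs, hrs, h⟩ := this
    exact ⟨rs, hrs.1, hrs.2, by exact_mod_cast h⟩

variable [IsNoetherianRing R]

theorem subsingleton_ext_of_isRegular {rs : List R} (hrs : ∀ r ∈ rs, r ∈ maximalIdeal R)
    (hreg : RingTheory.Sequence.IsRegular R rs) (E : ModuleCat.{u} R) [Module.Finite R E]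
    (hE : ∀ x ∈ maximalIdeal R, ∀ y : E, x • y = 0) {i : ℕ} (hi : i < rs.length) :
    Subsingleton (Abelian.Ext E (ModuleCat.of R R) i) := by
  refine ModuleCat.subsingleton_ext_of_exists_isRegular (maximalIdeal R) E ?_ (ModuleCat.of R R)
    ?_ rs hrs hreg i hi
  · rw [Module.support_eq_zeroLocus]
    exact PrimeSpectrum.zeroLocus_anti_mono fun x hx => Module.mem_annihilator.2 (hE x hx)
  · rw [lt_top_iff_ne_top]
    change maximalIdeal R • (⊤ : Ideal R) ≠ ⊤
    simpa using (maximalIdeal.isMaximal R).ne_top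

/-- If there is a regular sequence of length `r` and `n ≤ r + 1`, then some syzygy `L` of the
residue field `k` has a transpose `T` with `Ext^i(T, R) = 0` for `1 ≤ i ≤ n`, and
`Ext^{j+n}(k, R)` is `Ext^j(L, R)` for `j ≥ 1`. -/
theorem exists_transpose_syzygy_residueField {rs : List R} (hrs : ∀ r ∈ rs, r ∈ maximalIdeal R)
    (hreg : RingTheory.Sequence.IsRegular R rs) {n : ℕ} (hn : n ≤ rs.length + 1) :
    ∃ L T : ModuleCat.{u} R, IsTranspose L T ∧
      (∀ x ∈ maximalIdeal R, ∀ j, ∀ e : Abelian.Ext L (ModuleCat.of R R) (j + 1), x • e = 0) ∧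
      (∀ j < n, Subsingleton (Abelian.Ext T (ModuleCat.of R R) (j + 1))) ∧
      ∀ j, Subsingleton (Abelian.Ext L (ModuleCat.of R R) (j + 1)) →
        Subsingleton (Abelian.Ext (ModuleCat.of R (ResidueField R)) (ModuleCat.of R R)
          (j + n + 1)) := by
  induction n with
  | zero =>
    have : Module.Finite R (ResidueField R) :=
      Module.Finite.of_surjective (Algebra.linearMap R (ResidueField R)) residue_surjective
    obtain ⟨T, hT⟩ := exists_isTranspose (ModuleCat.of R (ResidueField R))
    exact ⟨_, T, hT, fun x hx j => smul_ext_eq_zero_of_forall_smul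
      (smul_residueField_eq_zero hx) _ _, by simp, fun j h => h⟩
  | succ n ih =>
    obtain ⟨M, T, hT, hM, h0, h1⟩ := ih (by omega)
    obtain ⟨L, T', hL, hT', hs⟩ := hT.exists_isTransposeShift
    refine ⟨L, T', hT', fun x hx j => ?_, fun j hj => ?_, fun j h => ?_⟩
    · obtain ⟨P, i, p, ⟨_, _⟩, hi, hex, hp⟩ := hL
      exact smul_ext_eq_zero_of_exact hi hex hp _ _ (subsingleton_ext_succ_of_projective P _ j) x
        (hM x hx (j + 1))
    · obtain ⟨hs1, E, hE, hs⟩ := hs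
      obtain _ | j := j
      · exact hs1
      have := hT.symm.finite
      rw [hs.subsingleton_ext_iff]
      -- The submodule `E` is killed by the maximal ideal, so its `Ext` into `R` vanishes below
      -- the length of the regular sequence.
      exact subsingleton_ext_right (K := ModuleCat.of R E) (P := T) (i := E.subtype) (p := E.mkQ)
        E.injective_subtype (LinearMap.exact_subtype_mkQ E) E.mkQ_surjective _ _
        (subsingleton_ext_of_isRegular hrs hreg (ModuleCat.of R E)
          (fun x hx y => Subtype.ext (hE x (hM x hx 0) y y.2)) (by omega)) (h0 j (by omega))
    · have := h1 (j + 1) ((hL.subsingleton_ext_iff _ j).2 h)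
      rwa [show j + 1 + n + 1 = j + (n + 1) + 1 by ring] at this

theorem localDepth_lt_top : localDepth R < ⊤ := by
  obtain ⟨d, hd⟩ := WithBot.ne_bot_iff_exists.1 (ringKrullDim_ne_bot (R := R))
  have hd_top : d < ⊤ := by
    have := ringKrullDim_lt_top (R := R)
    rw [← hd] at this
    exact WithBot.coe_lt_coe.1 this
  refine lt_of_le_of_lt (iSup₂_le fun rs hrs => ?_) hd_top
  have h := ringKrullDim_add_length_eq_ringKrullDim_of_isRegular rs hrs.2
  have : Nontrivial (R ⧸ Ideal.ofList rs) := Ideal.Quotient.nontrivial_iff.2 fun h =>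
    hrs.2.top_ne_smul (by simp [h])
  have h0 : (0 : WithBot ℕ∞) ≤ ringKrullDim (R ⧸ Ideal.ofList rs) :=
    ringKrullDim_nonneg_of_nontrivial
  have h1 : (rs.length : WithBot ℕ∞) ≤ d := by
    rw [hd, ← h]
    exact le_add_of_nonneg_left h0
  exact_mod_cast h1

/-- Over a local ring of depth greater than `n`, the residue field lies in `𝒢_{n,0}` but is not
torsionless, hence not totally reflexive. -/
theorem localDepth_le_of_gClass_eq {n : ℕ} (h : GClass R n 0 = TotallyReflexive R) :
    localDepth R ≤ n := by
  by_contra hlt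
  rw [not_le] at hlt
  obtain ⟨rs, hrs, hreg, hlen⟩ := exists_isRegular_of_le_localDepth (R := R) (n := n + 1)
    (by exact_mod_cast Order.add_one_le_of_lt hlt)
  have : Module.Finite R (ResidueField R) :=
    Module.Finite.of_surjective (Algebra.linearMap R (ResidueField R)) residue_surjective
  have hext : ∀ i ≤ n, Subsingleton
      (Abelian.Ext (ModuleCat.of R (ResidueField R)) (ModuleCat.of R R) i) := fun i hi =>
    subsingleton_ext_of_isRegular hrs hreg _ (fun x hx => smul_residueField_eq_zero hx)
      (by omega)
  have hk : TotallyReflexive R (ModuleCat.of R (ResidueField R)) := by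
    rw [← h]
    refine ⟨‹_›, fun i _ hi => hext i (by exact_mod_cast hi), fun T _ i h1 h0 => ?_⟩
    have : i ≤ 0 := by exact_mod_cast h0
    omega
  obtain ⟨T, hT⟩ := exists_isTranspose (ModuleCat.of R (ResidueField R))
  refine one_ne_zero (α := ResidueField R)
    (hT.subsingleton_ext_one_iff.1 (hk.subsingleton_ext_transpose hT 0) 1 fun f => ?_)
  have hf := (Abelian.Ext.mk₀_bijective _ _).1
    (@Subsingleton.elim _ (hext 0 (Nat.zero_le n)) (Abelian.Ext.mk₀ (ModuleCat.ofHom f))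
      (Abelian.Ext.mk₀ 0))
  exact congrArg (fun g => g.hom (1 : ResidueField R)) hf

end

/-! ### A criterion for finite injective dimension -/

section

open IsLocalRing

variable {R : Type u} [CommRing R]

/-- Baer's criterion for the injective dimension. -/
theorem hasInjectiveDimensionLE_of_forall_ideal (M : ModuleCat.{u} R) (d : ℕ)
    (h : ∀ I : Ideal R, Subsingleton (Abelian.Ext (ModuleCat.of R (R ⧸ I)) M (d + 1))) :
    HasInjectiveDimensionLE M d := by
  induction d generalizing M with
  | zero =>
    rw [HasInjectiveDimensionLE, zero_add, ← injective_iff_hasInjectiveDimensionLT_one,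
      ← Module.injective_iff_injective_object R M, ← Module.Baer.iff_injective]
    intro I g
    have : Module.Projective R (ModuleCat.of R R) := inferInstanceAs (Module.Projective R R)
    obtain ⟨g', hg'⟩ := (subsingleton_ext_one_iff (K := ModuleCat.of R I) (P := ModuleCat.of R R)
      (N := ModuleCat.of R (R ⧸ I)) (Submodule.injective_subtype I)
      (LinearMap.exact_subtype_mkQ I) (Submodule.mkQ_surjective I) M).1 (h I) g
    exact ⟨g', fun x hx => LinearMap.congr_fun hg' ⟨x, hx⟩⟩
  | succ d ih =>
    obtain ⟨J, _, f, _⟩ := EnoughInjectives.presentation M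
    have hf : Function.Injective f.hom := (ModuleCat.mono_iff_injective f).1 ‹_›
    have hS := shortExact_of_exact (N := ModuleCat.of R (J ⧸ LinearMap.range f.hom)) hf
      f.hom.exact_map_mkQ_range (Submodule.mkQ_surjective _)
    refine (hS.hasInjectiveDimensionLT_X₃_iff d ‹_›).1 (ih _ fun I => ?_)
    refine subsingleton_of_forall_eq 0 fun e => ?_
    obtain ⟨y, hy⟩ := Abelian.Ext.covariant_sequence_exact₃ _ hS e rfl
      (@Subsingleton.elim _ (h I) _ _)
    rw [← hy, Abelian.Ext.eq_zero_of_injective y, Abelian.Ext.zero_comp]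

variable [IsNoetherianRing R] [IsLocalRing R]

/-- Vanishing of `Ext` on the residue field in all large degrees propagates to all finitely
generated modules: by noetherian induction on primes `p`, an element `x ∉ p` of the maximal ideal
acts surjectively on `Ext^i(R ⧸ p, Y)`, which therefore vanishes by Nakayama's lemma. -/
theorem subsingleton_ext_of_residueField (Y : ModuleCat.{u} R) [Module.Finite R Y] (d : ℕ)
    (h : ∀ i ≥ d, Subsingleton (Abelian.Ext (ModuleCat.of R (ResidueField R)) Y i))
    (M : ModuleCat.{u} R) [Module.Finite R M] : ∀ i ≥ d, Subsingleton (Abelian.Ext M Y i) := by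
  -- Prime filtrations reduce the vanishing on finitely generated modules to the vanishing on
  -- the factors `R ⧸ p`.
  have reduction : ∀ (N : Type u) [AddCommGroup N] [Module R N] [Module.Finite R N],
      (∀ p : PrimeSpectrum R, Module.annihilator R N ≤ p.asIdeal →
        ∀ i ≥ d, Subsingleton (Abelian.Ext (ModuleCat.of R (R ⧸ p.asIdeal)) Y i)) →
      ∀ i ≥ d, Subsingleton (Abelian.Ext (ModuleCat.of R N) Y i) := by
    intro N _ _ hN
    induction hN using IsNoetherianRing.induction_on_isQuotientEquivQuotientPrime R with
    | subsingleton N =>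
      intro _ i _
      have : Limits.IsZero (ModuleCat.of R N) := ModuleCat.isZero_of_subsingleton _
      refine subsingleton_of_forall_eq 0 fun e => ?_
      rw [← Abelian.Ext.mk₀_id_comp e, this.eq_of_src (𝟙 _) 0, Abelian.Ext.mk₀_zero,
        Abelian.Ext.zero_comp]
    | quotient N p e =>
      intro hp i hi
      exact subsingleton_ext_of_linearEquiv (M := ModuleCat.of R (R ⧸ p.asIdeal)) e.symm Y i
        (hp p (by rw [e.annihilator_eq, Ideal.annihilator_quotient]) i hi)
    | exact N₁ N₂ N₃ f g hf hg hfg h₁ h₃ =>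
      intro hp i hi
      exact subsingleton_ext_middle (K := ModuleCat.of R N₁) (P := ModuleCat.of R N₂)
        (N := ModuleCat.of R N₃) hf hfg hg Y i
        (h₁ (fun p hle => hp p ((f.annihilator_le_of_injective hf).trans hle)) i hi)
        (h₃ (fun p hle => hp p ((g.annihilator_le_of_surjective hg).trans hle)) i hi)
  have primes : ∀ (p : PrimeSpectrum R), ∀ i ≥ d,
      Subsingleton (Abelian.Ext (ModuleCat.of R (R ⧸ p.asIdeal)) Y i) := by
    intro p
    obtain ⟨p, hp⟩ := p
    induction p using WellFoundedGT.induction with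
    | ind p ih =>
    by_cases hmax : p = maximalIdeal R
    · subst hmax
      exact h
    intro i hi
    obtain ⟨x, hx, hxp⟩ := SetLike.exists_of_lt ((le_maximalIdeal hp.ne_top).lt_of_ne hmax)
    let μ : (R ⧸ p) →ₗ[R] (R ⧸ p) := LinearMap.lsmul R (R ⧸ p) x
    have hμ : Function.Injective μ := by
      rw [injective_iff_map_eq_zero]
      intro y hy
      obtain ⟨y, rfl⟩ := Ideal.Quotient.mk_surjective y
      have : x * y ∈ p := Ideal.Quotient.eq_zero_iff_mem.1 hy
      exact Ideal.Quotient.eq_zero_iff_mem.2 ((hp.mem_or_mem this).resolve_left hxp)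
    let C := (R ⧸ p) ⧸ LinearMap.range μ
    have hC : Subsingleton (Abelian.Ext (ModuleCat.of R C) Y (i + 1)) := by
      refine reduction C (fun q hq => ih q.asIdeal (lt_of_le_of_ne ?_ ?_) q.2) (i + 1) (by omega)
      · refine le_trans (fun r hr => Module.mem_annihilator.2 fun y => ?_) hq
        obtain ⟨y, rfl⟩ := Submodule.mkQ_surjective _ y
        obtain ⟨y, rfl⟩ := Ideal.Quotient.mk_surjective y
        rw [← map_smul]
        have : r • Ideal.Quotient.mk p y = 0 :=
          Ideal.Quotient.eq_zero_iff_mem.2 (p.mul_mem_right y hr)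
        rw [this, map_zero]
      · rintro rfl
        refine hxp (hq (Module.mem_annihilator.2 fun y => ?_))
        obtain ⟨y, rfl⟩ := Submodule.mkQ_surjective _ y
        rw [← map_smul]
        exact (Submodule.Quotient.mk_eq_zero _).2 ⟨y, rfl⟩
    have hS := shortExact_of_exact (K := ModuleCat.of R (R ⧸ p)) (P := ModuleCat.of R (R ⧸ p))
      (N := ModuleCat.of R C) hμ μ.exact_map_mkQ_range (Submodule.mkQ_surjective _)
    have hsurj : ∀ e : Abelian.Ext (ModuleCat.of R (R ⧸ p)) Y i, ∃ e', x • e' = e := by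
      intro e
      obtain ⟨e', he'⟩ := Abelian.Ext.contravariant_sequence_exact₁ hS Y e (add_comm 1 i)
        (@Subsingleton.elim _ hC _ _)
      refine ⟨e', ?_⟩
      rw [← he', ← Abelian.Ext.mk₀_id_comp e', ← Abelian.Ext.smul_comp, ← Abelian.Ext.mk₀_smul,
        Abelian.Ext.mk₀_id_comp]
      rfl
    have hfin : Module.Finite R (Abelian.Ext (ModuleCat.of R (R ⧸ p)) Y i) := inferInstance
    rw [← Submodule.subsingleton_iff R, ← subsingleton_iff_bot_eq_top, eq_comm]
    refine Submodule.eq_bot_of_le_smul_of_le_jacobson_bot (maximalIdeal R) ⊤ hfin.fg_top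
      (fun e _ => ?_) (IsLocalRing.jacobson_eq_maximalIdeal ⊥ bot_ne_top).ge
    obtain ⟨e', rfl⟩ := hsurj e
    exact Submodule.smul_mem_smul hx trivial
  exact reduction M fun p _ => primes p

theorem isGorensteinLocalRing_of_subsingleton_ext (d : ℕ)
    (h : ∀ i ≥ d, Subsingleton (Abelian.Ext (ModuleCat.of R (ResidueField R)) (ModuleCat.of R R) i))
    : IsGorensteinLocalRing R := by
  have : Module.Finite R (ModuleCat.of R R) := inferInstanceAs (Module.Finite R R)
  exact ⟨inferInstance, inferInstance, d, hasInjectiveDimensionLE_of_forall_ideal _ d fun I =>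
    subsingleton_ext_of_residueField _ d h (ModuleCat.of R (R ⧸ I)) (d + 1) (by omega)⟩

end

/-! ### The two characterizations -/

theorem proposition5p7 (R : Type u) [CommRing R] [IsNoetherianRing R] :
    (∀ a b : ℕ∞, 0 < a → a < ⊤ →
      (ClosedUnderSyzygies (GClass R a b) ↔ GClass R a b = TotallyReflexive R)) ∧
    (∀ [IsLocalRing R] (n : ℕ∞), 0 < n → ClosedUnderSyzygies (GClass R n 0) →
      localDepth R ≤ n ∧ (n ≤ localDepth R + 1 → IsGorensteinLocalRing R)) := by
  refine ⟨fun a b ha ha' => ⟨gClass_eq_totallyReflexive ha ha', fun h => ?_⟩, fun n hn h => ?_⟩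
  · rw [h]
    exact closedUnderSyzygies_totallyReflexive R
  obtain rfl | hn' := eq_or_ne n ⊤
  · refine ⟨le_top, fun h' => ?_⟩
    exact absurd (top_le_iff.1 h') (WithTop.add_ne_top.2 ⟨localDepth_lt_top.ne, ENat.one_ne_top⟩)
  lift n to ℕ using hn'
  have heq := gClass_eq_totallyReflexive hn (ENat.natCast_lt_top n) h
  refine ⟨localDepth_le_of_gClass_eq heq, fun hle => ?_⟩
  obtain ⟨m, rfl⟩ := Nat.exists_eq_add_of_le' (show 1 ≤ n by exact_mod_cast hn)
  have hm : (m : ℕ∞) ≤ localDepth R := by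
    rw [Nat.cast_add, Nat.cast_one] at hle
    exact (ENat.add_le_add_iff_right ENat.one_ne_top).1 hle
  obtain ⟨rs, hrs, hreg, hlen⟩ := exists_isRegular_of_le_localDepth hm
  obtain ⟨L, T, hT, -, hext, hk⟩ := exists_transpose_syzygy_residueField hrs hreg
    (show m + 1 ≤ rs.length + 1 by omega)
  have hTR : TotallyReflexive R T := by
    rw [← heq]
    refine ⟨hT.symm.finite, fun i hi him => ?_, fun S _ i h1 h0 => ?_⟩
    · obtain ⟨i, rfl⟩ := Nat.exists_eq_add_of_le' hi
      exact hext i (by exact_mod_cast him)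
    · have : i ≤ 0 := by exact_mod_cast h0
      omega
  refine isGorensteinLocalRing_of_subsingleton_ext (m + 2) fun i hi => ?_
  obtain ⟨j, rfl⟩ := Nat.exists_eq_add_of_le' hi
  exact hk j (hTR.subsingleton_ext_transpose hT.symm j)
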